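/- Let $M$ be a smooth manifold with a hypercomplex structure, i.e. three integrable complex structures $I_1,I_2,I_3$ with $I_1I_2=I_3=-I_2I_1$, and let $F_2,F_3$ be smooth real 2-forms on $M$ such that $F_2-iF_3$ is of type $(0,2)$ with respect to $I_1$. For a complex structure $J$, let it act on 2-forms by $(J\omega)(X,Y)=\omega(JX,JY)$ and on 3-forms by $(J\omega)(X,Y,Z)=-\omega(JX,JY,JZ)$, and on 2-forms put $d^c=JdJ$, $\partial=\tfrac12(d+id^c)$, $\bar\partial=\tfrac12(d-id^c)$; write $\partial_1,\bar\partial_1$ for the operators of $J=I_1$. Suppose that $$g(X,Y)=-F_2(I_2X,Y)$$ is a positive definite symmetric bilinear form on every tangent space. Then $\bar\partial_1(F_2-iF_3)=0$ if and only if $\partial_1(F_2+iF_3)=0$. If these equations hold, then $g$ is a smooth hyper-Hermitian Riemannian metric, i.e. $g(JX,JY)=g(X,Y)$ for every $J=a_1I_1+a_2I_2+a_3I_3$ with $a_1^2+a_2^2+a_3^2=1$, and $(M,I_1,I_2,I_3,g)$ is an HKT-structure: there is a smooth linear connection $\nabla$ on $M$ with $\nabla g=0$ and $\nabla I_1=\nabla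 I_2=\nabla I_3=0$, whose torsion $T$ is totally skew-symmetric, i.e. $c(X,Y,Z)=g(X,T(Y,Z))$ is a 3-form. -/

import Mathlib

open Bundle
open scoped Manifold ContDiff

/-! Throughout, `M` is a smooth manifold (without boundary) modelled on a finite-dimensional real
normed space `E`. Identities between tensors are tested at a point `x` on arbitrary vector fields
that are differentiable at `x`. -/

namespace HKT

noncomputable section

section ComplexForms

variable {E : Type*} [NormedAddCommGroup E] [NormedSpace ℝ E]
  {M : Type*} [TopologicalSpace M] [ChartedSpace E M]

/-- The complex-valued form `α + c β`, for real-valued forms `α`, `β` and a complex number `c`. -/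
def complexForm (α β : ∀ x : M, TangentSpace 𝓘(ℝ, E) x →L[ℝ] TangentSpace 𝓘(ℝ, E) x →L[ℝ] ℝ)
    (c : ℂ) (x : M) : TangentSpace 𝓘(ℝ, E) x →L[ℝ] TangentSpace 𝓘(ℝ, E) x →L[ℝ] ℂ :=
  (ContinuousLinearMap.postcomp _ Complex.ofRealCLM).comp (α x)
    + c • (ContinuousLinearMap.postcomp _ Complex.ofRealCLM).comp (β x)

theorem complexForm_apply
    (α β : ∀ x : M, TangentSpace 𝓘(ℝ, E) x →L[ℝ] TangentSpace 𝓘(ℝ, E) x →L[ℝ] ℝ)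
    (c : ℂ) (x : M) (v w : TangentSpace 𝓘(ℝ, E) x) :
    complexForm α β c x v w = (α x v w : ℂ) + c * (β x v w : ℂ) := rfl

end ComplexForms

section Tensors

variable {E : Type*} [NormedAddCommGroup E] [NormedSpace ℝ E]
  {M : Type*} [TopologicalSpace M] [ChartedSpace E M] [IsManifold 𝓘(ℝ, E) ∞ M]

/-- The Nijenhuis tensor `[JX, JY] - J[JX, Y] - J[X, JY] - [X, Y]` of an almost complex
structure `J`. -/
def nijenhuis
    (J : ∀ x : M, TangentSpace 𝓘(ℝ, E) x →L[ℝ] TangentSpace 𝓘(ℝ, E) x)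
    (X Y : ∀ x : M, TangentSpace 𝓘(ℝ, E) x) (x : M) : TangentSpace 𝓘(ℝ, E) x :=
  VectorField.mlieBracket 𝓘(ℝ, E) (fun y ↦ J y (X y)) (fun y ↦ J y (Y y)) x
    - J x (VectorField.mlieBracket 𝓘(ℝ, E) (fun y ↦ J y (X y)) Y x)
    - J x (VectorField.mlieBracket 𝓘(ℝ, E) X (fun y ↦ J y (Y y)) x)
    - VectorField.mlieBracket 𝓘(ℝ, E) X Y x

/-- The exterior derivative of a `V`-valued 2-form `η`, evaluated on vector fields:
`dη(X,Y,Z) = X(η(Y,Z)) + Y(η(Z,X)) + Z(η(X,Y)) - η([X,Y],Z) - η([Y,Z],X) - η([Z,X],Y)`. -/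
def extDerivTwo {V : Type*} [NormedAddCommGroup V] [NormedSpace ℝ V]
    (η : ∀ x : M, TangentSpace 𝓘(ℝ, E) x →L[ℝ] TangentSpace 𝓘(ℝ, E) x →L[ℝ] V)
    (X Y Z : ∀ x : M, TangentSpace 𝓘(ℝ, E) x) (x : M) : V :=
  d% (fun y ↦ η y (Y y) (Z y)) x (X x)
    + d% (fun y ↦ η y (Z y) (X y)) x (Y x)
    + d% (fun y ↦ η y (X y) (Y y)) x (Z x)
    - η x (VectorField.mlieBracket 𝓘(ℝ, E) X Y x) (Z x)
    - η x (VectorField.mlieBracket 𝓘(ℝ, E) Y Z x) (X x)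
    - η x (VectorField.mlieBracket 𝓘(ℝ, E) Z X x) (Y x)

/-- The action of `J` on 2-forms, `(Jη)(X,Y) = η(JX,JY)`. -/
def actTwo {V : Type*} [NormedAddCommGroup V] [NormedSpace ℝ V]
    (J : ∀ x : M, TangentSpace 𝓘(ℝ, E) x →L[ℝ] TangentSpace 𝓘(ℝ, E) x)
    (η : ∀ x : M, TangentSpace 𝓘(ℝ, E) x →L[ℝ] TangentSpace 𝓘(ℝ, E) x →L[ℝ] V)
    (x : M) : TangentSpace 𝓘(ℝ, E) x →L[ℝ] TangentSpace 𝓘(ℝ, E) x →L[ℝ] V :=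
  (ContinuousLinearMap.precomp V (J x)).comp ((η x).comp (J x))

/-- The operator `d^c = J d J` on 2-forms, where `J` acts on a 3-form `θ` by
`(Jθ)(X,Y,Z) = -θ(JX,JY,JZ)`. -/
def dcTwo {V : Type*} [NormedAddCommGroup V] [NormedSpace ℝ V]
    (J : ∀ x : M, TangentSpace 𝓘(ℝ, E) x →L[ℝ] TangentSpace 𝓘(ℝ, E) x)
    (η : ∀ x : M, TangentSpace 𝓘(ℝ, E) x →L[ℝ] TangentSpace 𝓘(ℝ, E) x →L[ℝ] V)
    (X Y Z : ∀ x : M, TangentSpace 𝓘(ℝ, E) x) (x : M) : V :=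
  - extDerivTwo (actTwo J η) (fun y ↦ J y (X y)) (fun y ↦ J y (Y y)) (fun y ↦ J y (Z y)) x

/-- The Dolbeault operator `∂ = (d + i d^c) / 2` of `J` on complex-valued 2-forms. -/
def delTwo
    (J : ∀ x : M, TangentSpace 𝓘(ℝ, E) x →L[ℝ] TangentSpace 𝓘(ℝ, E) x)
    (η : ∀ x : M, TangentSpace 𝓘(ℝ, E) x →L[ℝ] TangentSpace 𝓘(ℝ, E) x →L[ℝ] ℂ)
    (X Y Z : ∀ x : M, TangentSpace 𝓘(ℝ, E) x) (x : M) : ℂ :=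
  (1 / 2) * (extDerivTwo η X Y Z x + Complex.I * dcTwo J η X Y Z x)

/-- The Dolbeault operator `∂̄ = (d - i d^c) / 2` of `J` on complex-valued 2-forms. -/
def delbarTwo
    (J : ∀ x : M, TangentSpace 𝓘(ℝ, E) x →L[ℝ] TangentSpace 𝓘(ℝ, E) x)
    (η : ∀ x : M, TangentSpace 𝓘(ℝ, E) x →L[ℝ] TangentSpace 𝓘(ℝ, E) x →L[ℝ] ℂ)
    (X Y Z : ∀ x : M, TangentSpace 𝓘(ℝ, E) x) (x : M) : ℂ :=
  (1 / 2) * (extDerivTwo η X Y Z x - Complex.I * dcTwo J η X Y Z x)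

/-- `∂η = 0` for the complex structure `J`. -/
def IsDelClosed
    (J : ∀ x : M, TangentSpace 𝓘(ℝ, E) x →L[ℝ] TangentSpace 𝓘(ℝ, E) x)
    (η : ∀ x : M, TangentSpace 𝓘(ℝ, E) x →L[ℝ] TangentSpace 𝓘(ℝ, E) x →L[ℝ] ℂ) : Prop :=
  ∀ (x : M) (X Y Z : ∀ x : M, TangentSpace 𝓘(ℝ, E) x),
    MDiffAt (T% X) x → MDiffAt (T% Y) x → MDiffAt (T% Z) x → delTwo J η X Y Z x = 0

/-- `∂̄η = 0` for the complex structure `J`. -/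
def IsDelbarClosed
    (J : ∀ x : M, TangentSpace 𝓘(ℝ, E) x →L[ℝ] TangentSpace 𝓘(ℝ, E) x)
    (η : ∀ x : M, TangentSpace 𝓘(ℝ, E) x →L[ℝ] TangentSpace 𝓘(ℝ, E) x →L[ℝ] ℂ) : Prop :=
  ∀ (x : M) (X Y Z : ∀ x : M, TangentSpace 𝓘(ℝ, E) x),
    MDiffAt (T% X) x → MDiffAt (T% Y) x → MDiffAt (T% Z) x → delbarTwo J η X Y Z x = 0

/-- A 2-form `η` has type `(0,2)` for `J`: its complex bilinear extension vanishes as soon as one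
argument is a `(1,0)`-vector `X - iJX`. -/
def IsTypeZeroTwo
    (J : ∀ x : M, TangentSpace 𝓘(ℝ, E) x →L[ℝ] TangentSpace 𝓘(ℝ, E) x)
    (η : ∀ x : M, TangentSpace 𝓘(ℝ, E) x →L[ℝ] TangentSpace 𝓘(ℝ, E) x →L[ℝ] ℂ) : Prop :=
  ∀ (x : M) (v w : TangentSpace 𝓘(ℝ, E) x),
    η x v w - Complex.I * η x (J x v) w = 0 ∧ η x v w - Complex.I * η x v (J x w) = 0

end Tensors

section Structures

variable (E : Type*) [NormedAddCommGroup E] [NormedSpace ℝ E]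
  (M : Type*) [TopologicalSpace M] [ChartedSpace E M] [IsManifold 𝓘(ℝ, E) ∞ M]

variable {E M} in
/-- An integrable complex structure on `M`: a smooth field of endomorphisms of the tangent bundle
with `J² = -1` and vanishing Nijenhuis tensor. -/
structure IsComplexStructure
    (J : ∀ x : M, TangentSpace 𝓘(ℝ, E) x →L[ℝ] TangentSpace 𝓘(ℝ, E) x) : Prop where
  contMDiff : ContMDiff 𝓘(ℝ, E) (𝓘(ℝ, E).prod 𝓘(ℝ, E →L[ℝ] E)) ∞
    (fun x ↦ TotalSpace.mk' (E →L[ℝ] E)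
      (E := fun x : M ↦ TangentSpace 𝓘(ℝ, E) x →L[ℝ] TangentSpace 𝓘(ℝ, E) x) x (J x))
  sq : ∀ (x : M) (v : TangentSpace 𝓘(ℝ, E) x), J x (J x v) = -v
  nijenhuis_eq_zero : ∀ (x : M) (X Y : ∀ x : M, TangentSpace 𝓘(ℝ, E) x),
    MDiffAt (T% X) x → MDiffAt (T% Y) x → nijenhuis J X Y x = 0

/-- A hypercomplex structure: complex structures with `I₁ I₂ = I₃ = -I₂ I₁`. -/
structure HypercomplexStructure where
  I₁ : ∀ x : M, TangentSpace 𝓘(ℝ, E) x →L[ℝ] TangentSpace 𝓘(ℝ, E) x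
  I₂ : ∀ x : M, TangentSpace 𝓘(ℝ, E) x →L[ℝ] TangentSpace 𝓘(ℝ, E) x
  I₃ : ∀ x : M, TangentSpace 𝓘(ℝ, E) x →L[ℝ] TangentSpace 𝓘(ℝ, E) x
  isComplex₁ : IsComplexStructure I₁
  isComplex₂ : IsComplexStructure I₂
  isComplex₃ : IsComplexStructure I₃
  mul₁₂ : ∀ (x : M) (v : TangentSpace 𝓘(ℝ, E) x), I₁ x (I₂ x v) = I₃ x v
  mul₂₁ : ∀ (x : M) (v : TangentSpace 𝓘(ℝ, E) x), I₂ x (I₁ x v) = -I₃ x v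

/-- Smooth Riemannian metrics on `M`. -/
abbrev Metric : Type _ :=
  ContMDiffRiemannianMetric 𝓘(ℝ, E) ∞ E (fun x : M ↦ TangentSpace 𝓘(ℝ, E) x)

/-- Linear connections on `M`; `∇_X Y` at `x` is `cov Y x (X x)`. -/
abbrev Connection : Type _ :=
  CovariantDerivative 𝓘(ℝ, E) E (fun x : M ↦ TangentSpace 𝓘(ℝ, E) x)

variable {E M}

/-- A smooth real-valued differential 2-form. -/
structure IsTwoForm
    (η : ∀ x : M, TangentSpace 𝓘(ℝ, E) x →L[ℝ] TangentSpace 𝓘(ℝ, E) x →L[ℝ] ℝ) : Prop where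
  contMDiff : ContMDiff 𝓘(ℝ, E) (𝓘(ℝ, E).prod 𝓘(ℝ, E →L[ℝ] E →L[ℝ] ℝ)) ∞
    (fun x ↦ TotalSpace.mk' (E →L[ℝ] E →L[ℝ] ℝ)
      (E := fun x : M ↦ TangentSpace 𝓘(ℝ, E) x →L[ℝ] TangentSpace 𝓘(ℝ, E) x →L[ℝ] ℝ) x (η x))
  alternating : ∀ (x : M) (v : TangentSpace 𝓘(ℝ, E) x), η x v v = 0

/-- `g` is Hermitian for `J`: `g(JX, JY) = g(X, Y)`. -/
def IsHermitian (g : Metric E M)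
    (J : ∀ x : M, TangentSpace 𝓘(ℝ, E) x →L[ℝ] TangentSpace 𝓘(ℝ, E) x) : Prop :=
  ∀ (x : M) (v w : TangentSpace 𝓘(ℝ, E) x), g.inner x (J x v) (J x w) = g.inner x v w

/-- `g` is hyper-Hermitian: Hermitian for every complex structure `a₁ I₁ + a₂ I₂ + a₃ I₃`,
`a₁² + a₂² + a₃² = 1`, of the hypercomplex structure. -/
def IsHyperHermitian (Q : HypercomplexStructure E M) (g : Metric E M) : Prop :=
  ∀ a₁ a₂ a₃ : ℝ, a₁ ^ 2 + a₂ ^ 2 + a₃ ^ 2 = 1 →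
    IsHermitian g (fun x ↦ a₁ • Q.I₁ x + a₂ • Q.I₂ x + a₃ • Q.I₃ x)

/-- `∇J = 0`, that is `∇_X (JY) = J ∇_X Y`. -/
def IsParallel (cov : Connection E M)
    (J : ∀ x : M, TangentSpace 𝓘(ℝ, E) x →L[ℝ] TangentSpace 𝓘(ℝ, E) x) : Prop :=
  ∀ (x : M) (Y : ∀ x : M, TangentSpace 𝓘(ℝ, E) x), MDiffAt (T% Y) x →
    ∀ u : TangentSpace 𝓘(ℝ, E) x, cov (fun y ↦ J y (Y y)) x u = J x (cov Y x u)

/-- `∇g = 0`, that is `X(g(Y,Z)) = g(∇_X Y, Z) + g(Y, ∇_X Z)`. -/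
def IsMetricConnection (g : Metric E M) (cov : Connection E M) : Prop :=
  ∀ (x : M) (Y Z : ∀ x : M, TangentSpace 𝓘(ℝ, E) x), MDiffAt (T% Y) x → MDiffAt (T% Z) x →
    ∀ u : TangentSpace 𝓘(ℝ, E) x,
      d% (fun y ↦ g.inner y (Y y) (Z y)) x u =
        g.inner x (cov Y x u) (Z x) + g.inner x (Y x) (cov Z x u)

variable [FiniteDimensional ℝ E]

/-- The tensor `c(X, Y, Z) = g(X, T(Y, Z))`, where `T` is the torsion of the connection. -/
def torsionForm (g : Metric E M) (cov : Connection E M) (x : M)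
    (u v w : TangentSpace 𝓘(ℝ, E) x) : ℝ :=
  haveI : CompleteSpace E := FiniteDimensional.complete ℝ E
  g.inner x u (CovariantDerivative.torsion cov x v w)

/-- A hyper-Hermitian connection: a smooth connection with `∇g = 0` and
`∇I₁ = ∇I₂ = ∇I₃ = 0`. -/
structure IsHyperHermitianConnection (Q : HypercomplexStructure E M) (g : Metric E M)
    (cov : Connection E M) : Prop where
  smooth : CovariantDerivative.ContMDiffCovariantDerivative cov ∞
  metric : IsMetricConnection g cov
  parallel₁ : IsParallel cov Q.I₁
  parallel₂ : IsParallel cov Q.I₂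
  parallel₃ : IsParallel cov Q.I₃

/-- A hyper-Kähler connection (with torsion): a hyper-Hermitian connection whose torsion tensor
`c` is totally skew-symmetric. -/
structure IsHyperKahlerConnection (Q : HypercomplexStructure E M) (g : Metric E M)
    (cov : Connection E M) : Prop extends IsHyperHermitianConnection Q g cov where
  skew₁₂ : ∀ (x : M) (u v w : TangentSpace 𝓘(ℝ, E) x),
    torsionForm g cov x u v w = -torsionForm g cov x v u w
  skew₂₃ : ∀ (x : M) (u v w : TangentSpace 𝓘(ℝ, E) x),
    torsionForm g cov x u v w = -torsionForm g cov x u w v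

/-- `(M, Q, g)` is an HKT-structure: a hyper-Hermitian manifold that admits a hyper-Kähler
connection. -/
structure IsHKT (Q : HypercomplexStructure E M) (g : Metric E M) : Prop where
  hyperHermitian : IsHyperHermitian Q g
  exists_connection : ∃ cov : Connection E M, IsHyperKahlerConnection Q g cov

end Structures

end

end HKT

namespace HKT

open scoped Topology

noncomputable section

/-! ### Exterior derivative of 2-forms: alternation and tensoriality. -/

section TensorCalculus

variable {E : Type*} [NormedAddCommGroup E] [NormedSpace ℝ E]
  {M : Type*} [TopologicalSpace M] [ChartedSpace E M]
  {b : ∀ x : M, TangentSpace 𝓘(ℝ, E) x →L[ℝ] TangentSpace 𝓘(ℝ, E) x →L[ℝ] ℝ}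
  {J : ∀ x : M, TangentSpace 𝓘(ℝ, E) x →L[ℝ] TangentSpace 𝓘(ℝ, E) x}
  {X X' Y Z : ∀ x : M, TangentSpace 𝓘(ℝ, E) x} {x : M}

/-! Since `F₂ - iF₃` has type (0,2), `I₁` acts on it by -1, so `d^c` of it is `dη(I₁·, I₁·, I₁·)`.
Splitting into real and imaginary parts, both closedness conditions become the same real system `dF₂
= dF₃(I₁·, I₁·, I₁·)`, `dF₃ = -dF₂(I₁·, I₁·, I₁·)`; the two conditions are complex conjugates of
each other.

The definition of `g` and the type condition give `F₂ = g(I₂·, ·)` and `F₃ = g(I₃·, ·)`. As both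
forms alternate, `I₂` and `I₃`, hence also `I₁ = I₂I₃`, are skew for `g`, which is therefore
hyper-Hermitian.

For any 3-form `c` the Koszul formula with an added term `c` defines a metric connection with
torsion form `c`. Bismut's identity (`koszul_complexStructure`) says that for a Hermitian structure
with fundamental form `η` the choice `c = dη(J·, J·, J·)` makes `J` parallel. Inserting `I₂X, I₂Y,
I₂Z` into the first real equation gives `dF₂(I₂·, I₂·, I₂·) = dF₃(I₃·, I₃·, I₃·)`: the Bismut
connections of `I₂` and `I₃` have the same torsion and are the same connection. It preserves `I₂`
and `I₃`, hence their product `I₁`. -/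

theorem extDerivTwo_swap_left (hb : ∀ x v w, b x v w = -b x w v) :
    extDerivTwo b Y X Z x = -extDerivTwo b X Y Z x := by
  have h (V W : ∀ x : M, TangentSpace 𝓘(ℝ, E) x) (u : TangentSpace 𝓘(ℝ, E) x) :
      d% (fun y ↦ b y (V y) (W y)) x u = -d% (fun y ↦ b y (W y) (V y)) x u := by
    have : (fun y ↦ b y (V y) (W y)) = fun y ↦ -(b y (W y) (V y)) := funext fun y ↦ hb y _ _
    rw [this, mvfderiv_fun_neg]; rfl
  unfold extDerivTwo
  rw [h X Z, h Z Y, h Y X, VectorField.mlieBracket_swap_apply (V := Y) (W := X),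
    VectorField.mlieBracket_swap_apply (V := X) (W := Z),
    VectorField.mlieBracket_swap_apply (V := Z) (W := Y)]
  simp only [map_neg, neg_apply]
  ring

theorem extDerivTwo_rotate : extDerivTwo b Y Z X x = extDerivTwo b X Y Z x := by
  unfold extDerivTwo
  ring

theorem extDerivTwo_swap_right (hb : ∀ x v w, b x v w = -b x w v) :
    extDerivTwo b X Z Y x = -extDerivTwo b X Y Z x := by
  rw [← extDerivTwo_rotate, extDerivTwo_swap_left hb, ← extDerivTwo_rotate,
    ← extDerivTwo_rotate]

variable [IsManifold 𝓘(ℝ, E) ∞ M]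

/-- Smoothness of a field of bilinear forms on the tangent bundle. -/
def IsSmoothBilin
    (b : ∀ x : M, TangentSpace 𝓘(ℝ, E) x →L[ℝ] TangentSpace 𝓘(ℝ, E) x →L[ℝ] ℝ) : Prop :=
  ContMDiff 𝓘(ℝ, E) (𝓘(ℝ, E).prod 𝓘(ℝ, E →L[ℝ] E →L[ℝ] ℝ)) ∞
    (fun x ↦ TotalSpace.mk' (E →L[ℝ] E →L[ℝ] ℝ)
      (E := fun x : M ↦ TangentSpace 𝓘(ℝ, E) x →L[ℝ] TangentSpace 𝓘(ℝ, E) x →L[ℝ] ℝ) x (b x))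

/-- Smoothness of a field of endomorphisms of the tangent bundle. -/
def IsSmoothEndo
    (J : ∀ x : M, TangentSpace 𝓘(ℝ, E) x →L[ℝ] TangentSpace 𝓘(ℝ, E) x) : Prop :=
  ContMDiff 𝓘(ℝ, E) (𝓘(ℝ, E).prod 𝓘(ℝ, E →L[ℝ] E)) ∞
    (fun x ↦ TotalSpace.mk' (E →L[ℝ] E)
      (E := fun x : M ↦ TangentSpace 𝓘(ℝ, E) x →L[ℝ] TangentSpace 𝓘(ℝ, E) x) x (J x))

theorem IsSmoothBilin.mdifferentiableAt (hb : IsSmoothBilin b)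
    (hX : MDiffAt (T% X) x) (hY : MDiffAt (T% Y) x) :
    MDiffAt (fun y ↦ b y (X y) (Y y)) x := by
  have h : MDifferentiableAt 𝓘(ℝ, E) (𝓘(ℝ, E).prod 𝓘(ℝ))
      (fun m ↦ TotalSpace.mk' ℝ (E := Bundle.Trivial M ℝ) m (b m (X m) (Y m))) x :=
    MDifferentiableAt.clm_bundle_apply₂ (F₁ := E) (F₂ := E)
      (ContMDiffAt.mdifferentiableAt (hb x) (by simp)) hX hY
  exact ((mdifferentiableAt_totalSpace ..).1 h).2

theorem IsSmoothBilin.contMDiffAt (hb : IsSmoothBilin b)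
    (hX : CMDiffAt ∞ (T% X) x) (hY : CMDiffAt ∞ (T% Y) x) :
    CMDiffAt ∞ (fun y ↦ b y (X y) (Y y)) x := by
  have h : ContMDiffAt 𝓘(ℝ, E) (𝓘(ℝ, E).prod 𝓘(ℝ)) ∞
      (fun m ↦ TotalSpace.mk' ℝ (E := Bundle.Trivial M ℝ) m (b m (X m) (Y m))) x :=
    ContMDiffAt.clm_bundle_apply₂ (F₁ := E) (F₂ := E) (hb x) hX hY
  exact (contMDiffAt_totalSpace.1 h).2

theorem IsSmoothEndo.mdifferentiableAt (hJ : IsSmoothEndo J) (hX : MDiffAt (T% X) x) :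
    MDiffAt (T% (fun y ↦ J y (X y))) x :=
  MDifferentiableAt.clm_bundle_apply (F₁ := E) (F₂ := E)
    (ContMDiffAt.mdifferentiableAt (hJ x) (by simp)) hX

theorem IsSmoothEndo.contMDiffAt (hJ : IsSmoothEndo J) (hX : CMDiffAt ∞ (T% X) x) :
    CMDiffAt ∞ (T% (fun y ↦ J y (X y))) x :=
  ContMDiffAt.clm_bundle_apply (F₁ := E) (F₂ := E) (hJ x) hX

variable [CompleteSpace E]

theorem extDerivTwo_add_left (hb : IsSmoothBilin b) (hX : MDiffAt (T% X) x)
    (hX' : MDiffAt (T% X') x) (hY : MDiffAt (T% Y) x) (hZ : MDiffAt (T% Z) x) :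
    extDerivTwo b (X + X') Y Z x = extDerivTwo b X Y Z x + extDerivTwo b X' Y Z x := by
  unfold extDerivTwo
  simp only [Pi.add_apply, map_add, add_apply]
  rw [mvfderiv_fun_add (hb.mdifferentiableAt hZ hX) (hb.mdifferentiableAt hZ hX'),
    mvfderiv_fun_add (hb.mdifferentiableAt hX hY) (hb.mdifferentiableAt hX' hY),
    VectorField.mlieBracket_add_left hX hX', VectorField.mlieBracket_add_right hX hX']
  simp only [map_add, add_apply]
  ring

/-- The derivatives of `f` from the Leibniz rule cancel those from the brackets `[fX, Y]` and `[Z,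
fX]`. By alternation, tensoriality in one slot suffices. -/
theorem extDerivTwo_smul_left (hb : IsSmoothBilin b) (hb' : ∀ x v w, b x v w = -b x w v)
    {f : M → ℝ} (hf : MDiffAt f x) (hX : MDiffAt (T% X) x)
    (hY : MDiffAt (T% Y) x) (hZ : MDiffAt (T% Z) x) :
    extDerivTwo b (f • X) Y Z x = f x * extDerivTwo b X Y Z x := by
  unfold extDerivTwo
  simp only [Pi.smul_apply', map_smul, smul_apply, smul_eq_mul]
  rw [mvfderiv_fun_mul hf (hb.mdifferentiableAt hZ hX),
    mvfderiv_fun_mul hf (hb.mdifferentiableAt hX hY),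
    VectorField.mlieBracket_smul_left hf hX, VectorField.mlieBracket_smul_right hf hX]
  simp only [map_add, add_apply, smul_apply, map_smul,
    smul_eq_mul]
  rw [hb' x (Z x) (X x)]
  simp
  ring

end TensorCalculus

/-! ### Smoothness of directional derivatives and Lie brackets. -/

section SmoothOperations

variable {E : Type*} [NormedAddCommGroup E] [NormedSpace ℝ E]
  {M : Type*} [TopologicalSpace M] [ChartedSpace E M] [IsManifold 𝓘(ℝ, E) ∞ M]
  {X Y : ∀ x : M, TangentSpace 𝓘(ℝ, E) x} {x : M}

theorem contMDiffAt_mvfderiv_apply {f : M → ℝ} (hf : CMDiffAt ∞ f x)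
    (hX : CMDiffAt ∞ (T% X) x) : CMDiffAt ∞ (fun y ↦ d% f y (X y)) x := by
  have h1 := ContMDiffAt.mfderiv_const (m := ∞) hf (by simp)
  have h2 : CMDiffAt ∞ (fun y ↦ (⟨f y, mfderiv% f y (X y)⟩ : TangentBundle 𝓘(ℝ, ℝ) ℝ)) x :=
    ContMDiffAt.clm_apply_of_inCoordinates h1 hX hf
  have h3 := (contMDiffAt_totalSpace.1 h2).2
  simpa [mvfderiv] using! h3

/-- Passes from identities tested on vector fields to identities between tangent vectors. -/
theorem exists_mdifferentiableAt_eq (v : TangentSpace 𝓘(ℝ, E) x) :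
    ∃ X : ∀ x : M, TangentSpace 𝓘(ℝ, E) x, MDiffAt (T% X) x ∧ X x = v :=
  ⟨FiberBundle.extend E v, FiberBundle.mdifferentiableAt_extend .., by simp⟩

theorem contMDiffAt_mlieBracket [CompleteSpace E] (hX : CMDiffAt ∞ (T% X) x)
    (hY : CMDiffAt ∞ (T% Y) x) :
    CMDiffAt ∞ (T% (VectorField.mlieBracket 𝓘(ℝ, E) X Y)) x := by
  have : IsManifold 𝓘(ℝ, E) (minSmoothness ℝ 2) M := by
    rw [minSmoothness_of_isRCLikeNormedField]; infer_instance
  have : IsManifold 𝓘(ℝ, E) (((⊤ : ℕ∞) : ℕ∞ω) + 1) M := by simpa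
  exact ContMDiffAt.mlieBracket_vectorField (m := (⊤ : ℕ∞)) (n := (⊤ : ℕ∞)) hX hY (by simp)

end SmoothOperations

/-! ### The Koszul expression with torsion. -/

section ThreeForms

variable {E : Type*} [NormedAddCommGroup E] [NormedSpace ℝ E]
  {M : Type*} [TopologicalSpace M] [ChartedSpace E M]

/-- Twice the right-hand side of the Koszul formula for the metric connection of `g` with
torsion 3-form `c`. -/
def koszul (g : ∀ x : M, TangentSpace 𝓘(ℝ, E) x →L[ℝ] TangentSpace 𝓘(ℝ, E) x →L[ℝ] ℝ)
    (c : (∀ x : M, TangentSpace 𝓘(ℝ, E) x) → (∀ x : M, TangentSpace 𝓘(ℝ, E) x) →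
      (∀ x : M, TangentSpace 𝓘(ℝ, E) x) → M → ℝ)
    (X Y Z : ∀ x : M, TangentSpace 𝓘(ℝ, E) x) (x : M) : ℝ :=
  d% (fun y ↦ g y (Y y) (Z y)) x (X x) + d% (fun y ↦ g y (X y) (Z y)) x (Y x)
    - d% (fun y ↦ g y (X y) (Y y)) x (Z x)
    + g x (VectorField.mlieBracket 𝓘(ℝ, E) X Y x) (Z x)
    - g x (VectorField.mlieBracket 𝓘(ℝ, E) X Z x) (Y x)
    - g x (VectorField.mlieBracket 𝓘(ℝ, E) Y Z x) (X x)
    + c X Y Z x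

variable {g : ∀ x : M, TangentSpace 𝓘(ℝ, E) x →L[ℝ] TangentSpace 𝓘(ℝ, E) x →L[ℝ] ℝ}
    {c : (∀ x : M, TangentSpace 𝓘(ℝ, E) x) → (∀ x : M, TangentSpace 𝓘(ℝ, E) x) →
      (∀ x : M, TangentSpace 𝓘(ℝ, E) x) → M → ℝ}
    {X X' Y Y' Z Z' : ∀ x : M, TangentSpace 𝓘(ℝ, E) x} {x : M}

theorem mvfderiv_symm (hg : ∀ x v w, g x v w = g x w v) :
    d% (fun y ↦ g y (X y) (Y y)) x = d% (fun y ↦ g y (Y y) (X y)) x := by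
  congr 1
  exact funext fun y ↦ hg y _ _

variable [IsManifold 𝓘(ℝ, E) ∞ M]

/-- A differential 3-form, given as a function of three vector fields. -/
structure IsThreeForm (c : (∀ x : M, TangentSpace 𝓘(ℝ, E) x) →
    (∀ x : M, TangentSpace 𝓘(ℝ, E) x) → (∀ x : M, TangentSpace 𝓘(ℝ, E) x) → M → ℝ) : Prop where
  swap_left : ∀ X Y Z x, c Y X Z x = -c X Y Z x
  swap_right : ∀ X Y Z x, c X Z Y x = -c X Y Z x
  add_left : ∀ {X X' Y Z : ∀ x : M, TangentSpace 𝓘(ℝ, E) x} {x : M}, MDiffAt (T% X) x →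
    MDiffAt (T% X') x → MDiffAt (T% Y) x → MDiffAt (T% Z) x →
    c (X + X') Y Z x = c X Y Z x + c X' Y Z x
  smul_left : ∀ {X Y Z : ∀ x : M, TangentSpace 𝓘(ℝ, E) x} {f : M → ℝ} {x : M}, MDiffAt f x →
    MDiffAt (T% X) x → MDiffAt (T% Y) x → MDiffAt (T% Z) x →
    c (f • X) Y Z x = f x * c X Y Z x
  contMDiffAt : ∀ {X Y Z : ∀ x : M, TangentSpace 𝓘(ℝ, E) x} {x : M}, CMDiffAt ∞ (T% X) x →
    CMDiffAt ∞ (T% Y) x → CMDiffAt ∞ (T% Z) x → CMDiffAt ∞ (c X Y Z) x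

/-- This is metric compatibility: the bracket terms and `c` are skew in the last two slots and drop
out. -/
theorem koszul_add_swap_right (hg : ∀ x v w, g x v w = g x w v) (hc : IsThreeForm c) :
    koszul g c X Y Z x + koszul g c X Z Y x = 2 * d% (fun y ↦ g y (Y y) (Z y)) x (X x) := by
  unfold koszul
  rw [hc.swap_right X Y Z, mvfderiv_symm (X := Z) (Y := Y) hg,
    VectorField.mlieBracket_swap_apply (V := Z) (W := Y)]
  simp only [map_neg, neg_apply]
  ring

/-- This identifies the torsion: antisymmetrizing `∇_X Y` leaves the bracket and `c`. -/
theorem koszul_sub_swap_left (hg : ∀ x v w, g x v w = g x w v) (hc : IsThreeForm c) :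
    koszul g c X Y Z x - koszul g c Y X Z x =
      2 * (g x (VectorField.mlieBracket 𝓘(ℝ, E) X Y x) (Z x) + c X Y Z x) := by
  unfold koszul
  rw [hc.swap_left X Y Z, mvfderiv_symm (X := Y) (Y := X) hg,
    VectorField.mlieBracket_swap_apply (V := Y) (W := X)]
  simp only [map_neg, neg_apply]
  ring

variable [CompleteSpace E]

theorem koszul_add_left (hg : IsSmoothBilin g) (hc : IsThreeForm c)
    (hX : MDiffAt (T% X) x) (hX' : MDiffAt (T% X') x) (hY : MDiffAt (T% Y) x)
    (hZ : MDiffAt (T% Z) x) :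
    koszul g c (X + X') Y Z x = koszul g c X Y Z x + koszul g c X' Y Z x := by
  unfold koszul
  simp only [Pi.add_apply, map_add, add_apply]
  rw [mvfderiv_fun_add (hg.mdifferentiableAt hX hZ) (hg.mdifferentiableAt hX' hZ),
    mvfderiv_fun_add (hg.mdifferentiableAt hX hY) (hg.mdifferentiableAt hX' hY),
    VectorField.mlieBracket_add_left hX hX', VectorField.mlieBracket_add_left hX hX',
    hc.add_left hX hX' hY hZ]
  simp only [map_add, add_apply]
  ring

theorem koszul_smul_left (hg : IsSmoothBilin g) (hc : IsThreeForm c) {f : M → ℝ} (hf : MDiffAt f x)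
    (hX : MDiffAt (T% X) x) (hY : MDiffAt (T% Y) x) (hZ : MDiffAt (T% Z) x) :
    koszul g c (f • X) Y Z x = f x * koszul g c X Y Z x := by
  unfold koszul
  simp only [Pi.smul_apply', map_smul, smul_apply, smul_eq_mul]
  rw [mvfderiv_fun_mul hf (hg.mdifferentiableAt hX hZ),
    mvfderiv_fun_mul hf (hg.mdifferentiableAt hX hY),
    VectorField.mlieBracket_smul_left hf hX, VectorField.mlieBracket_smul_left hf hX,
    hc.smul_left hf hX hY hZ]
  simp only [map_add, add_apply, smul_apply, map_smul, smul_eq_mul, map_neg, neg_apply, neg_smul]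
  ring

theorem koszul_add_right (hg : IsSmoothBilin g) (hc : IsThreeForm c)
    (hX : MDiffAt (T% X) x) (hY : MDiffAt (T% Y) x) (hZ : MDiffAt (T% Z) x)
    (hZ' : MDiffAt (T% Z') x) :
    koszul g c X Y (Z + Z') x = koszul g c X Y Z x + koszul g c X Y Z' x := by
  have hc' : c X Y (Z + Z') x = c X Y Z x + c X Y Z' x := by
    have h (W : ∀ x : M, TangentSpace 𝓘(ℝ, E) x) : c X Y W x = c W X Y x := by
      rw [hc.swap_right, hc.swap_left, neg_neg]
    rw [h, h, h, hc.add_left hZ hZ' hX hY]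
  unfold koszul
  simp only [Pi.add_apply, map_add]
  rw [mvfderiv_fun_add (hg.mdifferentiableAt hX hZ) (hg.mdifferentiableAt hX hZ'),
    mvfderiv_fun_add (hg.mdifferentiableAt hY hZ) (hg.mdifferentiableAt hY hZ'),
    VectorField.mlieBracket_add_right hZ hZ', VectorField.mlieBracket_add_right hZ hZ', hc']
  simp only [map_add, add_apply]
  ring

theorem koszul_smul_right (hg : IsSmoothBilin g) (hg' : ∀ x v w, g x v w = g x w v)
    (hc : IsThreeForm c) {f : M → ℝ} (hf : MDiffAt f x)
    (hX : MDiffAt (T% X) x) (hY : MDiffAt (T% Y) x) (hZ : MDiffAt (T% Z) x) :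
    koszul g c X Y (f • Z) x = f x * koszul g c X Y Z x := by
  have hc' : c X Y (f • Z) x = f x * c X Y Z x := by
    have h (W : ∀ x : M, TangentSpace 𝓘(ℝ, E) x) : c X Y W x = c W X Y x := by
      rw [hc.swap_right, hc.swap_left, neg_neg]
    rw [h, h, hc.smul_left hf hZ hX hY]
  unfold koszul
  simp only [Pi.smul_apply', map_smul, smul_eq_mul]
  rw [mvfderiv_fun_mul hf (hg.mdifferentiableAt hX hZ),
    mvfderiv_fun_mul hf (hg.mdifferentiableAt hY hZ),
    VectorField.mlieBracket_smul_right hf hZ, VectorField.mlieBracket_smul_right hf hZ, hc']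
  simp only [map_add, add_apply, smul_apply, map_smul, smul_eq_mul]
  rw [hg' x (Z x) (X x), hg' x (Z x) (Y x)]
  ring

theorem koszul_add_middle (hg : IsSmoothBilin g) (hc : IsThreeForm c)
    (hX : MDiffAt (T% X) x) (hY : MDiffAt (T% Y) x) (hY' : MDiffAt (T% Y') x)
    (hZ : MDiffAt (T% Z) x) :
    koszul g c X (Y + Y') Z x = koszul g c X Y Z x + koszul g c X Y' Z x := by
  have hc' : c X (Y + Y') Z x = c X Y Z x + c X Y' Z x := by
    have h (W : ∀ x : M, TangentSpace 𝓘(ℝ, E) x) : c X W Z x = -c W X Z x := hc.swap_left ..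
    rw [h, h, h, hc.add_left hY hY' hX hZ, neg_add]
  unfold koszul
  simp only [Pi.add_apply, map_add, add_apply]
  rw [mvfderiv_fun_add (hg.mdifferentiableAt hX hY) (hg.mdifferentiableAt hX hY'),
    mvfderiv_fun_add (hg.mdifferentiableAt hY hZ) (hg.mdifferentiableAt hY' hZ),
    VectorField.mlieBracket_add_right hY hY', VectorField.mlieBracket_add_left hY hY', hc']
  simp only [map_add, add_apply]
  ring

/-- In the differentiated slot the derivatives of `f` do not all cancel; the surviving one is the
Leibniz term, doubled because `koszul` is twice `g(∇_X Y, Z)`. -/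
theorem koszul_smul_middle (hg : IsSmoothBilin g) (hg' : ∀ x v w, g x v w = g x w v)
    (hc : IsThreeForm c) {f : M → ℝ} (hf : MDiffAt f x)
    (hX : MDiffAt (T% X) x) (hY : MDiffAt (T% Y) x) (hZ : MDiffAt (T% Z) x) :
    koszul g c X (f • Y) Z x = f x * koszul g c X Y Z x + 2 * (d% f x (X x) * g x (Y x) (Z x)) := by
  have hc' : c X (f • Y) Z x = f x * c X Y Z x := by
    have h (W : ∀ x : M, TangentSpace 𝓘(ℝ, E) x) : c X W Z x = -c W X Z x := hc.swap_left ..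
    rw [h, h, hc.smul_left hf hY hX hZ, mul_neg]
  unfold koszul
  simp only [Pi.smul_apply', map_smul, smul_apply, smul_eq_mul]
  rw [mvfderiv_fun_mul hf (hg.mdifferentiableAt hX hY),
    mvfderiv_fun_mul hf (hg.mdifferentiableAt hY hZ),
    VectorField.mlieBracket_smul_right hf hY, VectorField.mlieBracket_smul_left hf hY, hc']
  simp only [map_add, add_apply, smul_apply, map_smul, smul_eq_mul, map_neg, neg_apply, neg_smul]
  rw [hg' x (Y x) (X x)]
  ring

theorem contMDiffAt_koszul (hg : IsSmoothBilin g) (hc : IsThreeForm c)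
    (hX : CMDiffAt ∞ (T% X) x) (hY : CMDiffAt ∞ (T% Y) x) (hZ : CMDiffAt ∞ (T% Z) x) :
    CMDiffAt ∞ (koszul g c X Y Z) x := by
  have h1 := contMDiffAt_mvfderiv_apply (hg.contMDiffAt hY hZ) hX
  have h2 := contMDiffAt_mvfderiv_apply (hg.contMDiffAt hX hZ) hY
  have h3 := contMDiffAt_mvfderiv_apply (hg.contMDiffAt hX hY) hZ
  have h4 := hg.contMDiffAt (contMDiffAt_mlieBracket hX hY) hZ
  have h5 := hg.contMDiffAt (contMDiffAt_mlieBracket hX hZ) hY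
  have h6 := hg.contMDiffAt (contMDiffAt_mlieBracket hY hZ) hX
  exact (((((h1.add h2).sub h3).add h4).sub h5).sub h6).add (hc.contMDiffAt hX hY hZ)

end ThreeForms

/-! ### Smoothness criteria through local frames. -/

section SmoothnessCriteria

variable {E : Type*} [NormedAddCommGroup E] [NormedSpace ℝ E]
  {M : Type*} [TopologicalSpace M] [ChartedSpace E M] [IsManifold 𝓘(ℝ, E) ∞ M]
  [FiniteDimensional ℝ E] {x : M}

/-- A field of linear maps on the tangent bundle is smooth if it maps smooth vector fields to
smooth sections. -/
theorem contMDiffAt_hom_of_apply {F : Type*} [NormedAddCommGroup F] [NormedSpace ℝ F]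
    {V : M → Type*} [TopologicalSpace (TotalSpace F V)] [∀ x, AddCommGroup (V x)]
    [∀ x, Module ℝ (V x)] [∀ x, TopologicalSpace (V x)] [∀ x, IsTopologicalAddGroup (V x)]
    [∀ x, ContinuousSMul ℝ (V x)] [FiberBundle F V] [VectorBundle ℝ F V]
    [ContMDiffVectorBundle ∞ F V 𝓘(ℝ, E)]
    {A : ∀ x : M, TangentSpace 𝓘(ℝ, E) x →L[ℝ] V x}
    (hA : ∀ X : ∀ x : M, TangentSpace 𝓘(ℝ, E) x, CMDiffAt ∞ (T% X) x →
      ContMDiffAt 𝓘(ℝ, E) (𝓘(ℝ, E).prod 𝓘(ℝ, F)) ∞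
        (fun y ↦ TotalSpace.mk' F y (A y (X y))) x) :
    ContMDiffAt 𝓘(ℝ, E) (𝓘(ℝ, E).prod 𝓘(ℝ, E →L[ℝ] F)) ∞
      (fun y ↦ TotalSpace.mk' (E →L[ℝ] F)
        (E := fun y : M ↦ TangentSpace 𝓘(ℝ, E) y →L[ℝ] V y) y (A y)) x := by
  rw [contMDiffAt_hom_bundle]
  refine ⟨contMDiffAt_id, ?_⟩
  let e := trivializationAt E (TangentSpace 𝓘(ℝ, E)) x
  have hxe : x ∈ e.baseSet := FiberBundle.mem_baseSet_trivializationAt' x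
  let b := Module.finBasis ℝ E
  -- In coordinates `A` is the sum over `i` of the `i`-th coordinate functional tensored with the
  -- image of the `i`-th frame field.
  have h (i) : ContMDiffAt 𝓘(ℝ, E) 𝓘(ℝ, E →L[ℝ] F) ∞
      (fun y ↦ (b.coord i).toContinuousLinearMap.smulRight
        (trivializationAt F V x ⟨y, A y (e.localFrame b i y)⟩).2) x := by
    have h1 := (contMDiffAt_section x).1
      (hA _ (contMDiffAt_localFrame_of_mem (I := 𝓘(ℝ, E)) ∞ e b i hxe))
    exact (((ContinuousLinearMap.smulRightL ℝ E F)
      (b.coord i).toContinuousLinearMap).contDiff.contMDiff.contMDiffAt).comp x h1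
  have hs := ContMDiffAt.sum (t := Finset.univ) fun i _ ↦ h i
  refine hs.congr_of_eventuallyEq ?_
  filter_upwards [e.open_baseSet.mem_nhds hxe,
    (trivializationAt F V x).open_baseSet.mem_nhds
      (FiberBundle.mem_baseSet_trivializationAt' x)] with y hy hy'
  apply ContinuousLinearMap.coe_injective
  refine b.ext fun j ↦ ?_
  simp only [ContinuousLinearMap.coe_coe, ContinuousLinearMap.inCoordinates_eq hy hy']
  rw [sum_apply, Finset.sum_eq_single j (fun i _ hi ↦ by simp [hi.symm]) (by simp)]
  rw [e.localFrame_apply_of_mem_baseSet b hy]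
  simp [e, Trivialization.basisAt]

/-- A vector field is smooth if its pairings with smooth vector fields under a positive definite
smooth bilinear form are smooth. -/
theorem contMDiffAt_of_pairing
    {g : ∀ x : M, TangentSpace 𝓘(ℝ, E) x →L[ℝ] TangentSpace 𝓘(ℝ, E) x →L[ℝ] ℝ}
    (hg : IsSmoothBilin g) (hpos : ∀ x v, v ≠ 0 → 0 < g x v v)
    {W : ∀ x : M, TangentSpace 𝓘(ℝ, E) x}
    (hW : ∀ Z : ∀ x : M, TangentSpace 𝓘(ℝ, E) x, CMDiffAt ∞ (T% Z) x →
      CMDiffAt ∞ (fun y ↦ g y (W y) (Z y)) x) :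
    CMDiffAt ∞ (T% W) x := by
  let e := trivializationAt E (TangentSpace 𝓘(ℝ, E)) x
  have hxe : x ∈ e.baseSet := FiberBundle.mem_baseSet_trivializationAt' x
  let b := Module.finBasis ℝ E
  let s := e.localFrame b
  have hs (i) : CMDiffAt ∞ (T% (s i)) x :=
    contMDiffAt_localFrame_of_mem (I := 𝓘(ℝ, E)) ∞ e b i hxe
  let fr := e.isLocalFrameOn_localFrame_baseSet 𝓘(ℝ, E) ∞ b
  -- The Gram matrix of the frame, as an operator on coefficient vectors. The coefficients of `W`
  -- are its inverse applied to the pairings of `W` with the frame, and operator inversion is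
  -- smooth.
  let L (y : M) : (Fin (Module.finrank ℝ E) → ℝ) →L[ℝ] (Fin (Module.finrank ℝ E) → ℝ) :=
    ∑ i, ∑ j, g y (s i y) (s j y) •
      (ContinuousLinearMap.single ℝ (fun _ ↦ ℝ) j).comp (ContinuousLinearMap.proj i)
  have hL : ContMDiffAt 𝓘(ℝ, E) 𝓘(ℝ, (Fin (Module.finrank ℝ E) → ℝ) →L[ℝ] (Fin (Module.finrank ℝ E) → ℝ)) ∞ L x :=
    ContMDiffAt.sum fun i _ ↦ ContMDiffAt.sum fun j _ ↦
      (hg.contMDiffAt (hs i) (hs j)).smul contMDiffAt_const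
  have hLa (y : M) (c : Fin (Module.finrank ℝ E) → ℝ) (j : Fin (Module.finrank ℝ E)) : L y c j = g y (∑ i, c i • s i y) (s j y) := by
    simp [L, Finset.sum_apply, Pi.single_apply, mul_comm]
  -- A vector orthogonal to every frame field is orthogonal to itself, hence zero by positivity.
  have hinv (y : M) (hy : y ∈ e.baseSet) : (L y).IsInvertible := by
    have hinj : Function.Injective (L y).toLinearMap := by
      rw [← LinearMap.ker_eq_bot, LinearMap.ker_eq_bot']
      intro c hc
      have h0 : ∑ i, c i • s i y = 0 := by
        have hc' (j) : g y (∑ i, c i • s i y) (s j y) = 0 := by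
          rw [← hLa]; exact congrFun hc j
        obtain ⟨V, hV⟩ : ∃ V, V = ∑ i, c i • s i y := ⟨_, rfl⟩
        rw [← hV] at hc' ⊢
        by_contra hne
        refine (hpos y _ hne).ne' ?_
        nth_rewrite 2 [hV]
        rw [map_sum]
        exact Finset.sum_eq_zero fun j _ ↦ by rw [map_smul, hc', smul_zero]
      exact funext fun i ↦ Fintype.linearIndependent_iff.1 (fr.linearIndependent hy) c h0 i
    exact ⟨(LinearEquiv.ofInjectiveEndo _ hinj).toContinuousLinearEquiv, by ext; rfl⟩
  refine fr.contMDiffAt_of_coeff (fun i ↦ ?_) (e.open_baseSet.mem_nhds hxe)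
  have hr : ContMDiffAt 𝓘(ℝ, E) 𝓘(ℝ, Fin (Module.finrank ℝ E) → ℝ) ∞ (fun y j ↦ g y (W y) (s j y)) x :=
    contMDiffAt_pi_space.2 fun j ↦ hW _ (hs j)
  have hLi : ContMDiffAt 𝓘(ℝ, E) 𝓘(ℝ, (Fin (Module.finrank ℝ E) → ℝ) →L[ℝ] (Fin (Module.finrank ℝ E) → ℝ)) ∞
      (fun y ↦ (L y).inverse) x :=
    ((hinv x hxe).contDiffAt_map_inverse.contMDiffAt).comp x hL
  have := contMDiffAt_pi_space.1 (hLi.clm_apply hr) i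
  refine this.congr_of_eventuallyEq ?_
  filter_upwards [e.open_baseSet.mem_nhds hxe] with y hy
  have h1 : (fun j ↦ g y (W y) (s j y)) = L y (fun i ↦ fr.coeff i y (W y)) := by
    funext j
    rw [hLa, ← fr.coeff_sum_eq W hy]
  rw [h1, (hinv y hy).inverse_apply_eq.2 rfl]
  rfl

end SmoothnessCriteria

/-! ### The metric connection with prescribed torsion 3-form. -/

section KoszulConnection

variable {E : Type*} [NormedAddCommGroup E] [NormedSpace ℝ E] [FiniteDimensional ℝ E]
  {M : Type*} [TopologicalSpace M] [ChartedSpace E M] [IsManifold 𝓘(ℝ, E) ∞ M]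

theorem Metric.isInvertible (g : Metric E M) (x : M) : (g.inner x).IsInvertible := by
  have : FiniteDimensional ℝ (TangentSpace 𝓘(ℝ, E) x) := inferInstanceAs (FiniteDimensional ℝ E)
  have : T2Space (TangentSpace 𝓘(ℝ, E) x) := inferInstanceAs (T2Space E)
  have hinj : Function.Injective (LinearMap.toContinuousLinearMap.symm.toLinearMap.comp
      (g.inner x).toLinearMap) := by
    rw [← LinearMap.ker_eq_bot, LinearMap.ker_eq_bot']
    intro v hv
    by_contra hne
    exact (g.pos x v hne).ne' (LinearMap.congr_fun hv v)
  let e := LinearEquiv.ofInjectiveOfFinrankEq _ hinj Subspace.dual_finrank_eq.symm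
  exact ⟨(e.trans LinearMap.toContinuousLinearMap).toContinuousLinearEquiv, by ext; rfl⟩

variable {c : (∀ x : M, TangentSpace 𝓘(ℝ, E) x) → (∀ x : M, TangentSpace 𝓘(ℝ, E) x) →
      (∀ x : M, TangentSpace 𝓘(ℝ, E) x) → M → ℝ}
    {X Y Z : ∀ x : M, TangentSpace 𝓘(ℝ, E) x} {x : M}

theorem tensorialAt_koszul_left (g : Metric E M) (hc : IsThreeForm c) (hY : MDiffAt (T% Y) x)
    (hZ : MDiffAt (T% Z) x) :
    TensorialAt 𝓘(ℝ, E) E (fun X ↦ koszul g.inner c X Y Z x) x :=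
  have := FiniteDimensional.complete ℝ E
  { smul := fun hf hX ↦ koszul_smul_left g.contMDiff hc hf hX hY hZ
    add := fun hX hX' ↦ koszul_add_left g.contMDiff hc hX hX' hY hZ }

theorem tensorialAt_koszul_right (g : Metric E M) (hc : IsThreeForm c) (hX : MDiffAt (T% X) x)
    (hY : MDiffAt (T% Y) x) :
    TensorialAt 𝓘(ℝ, E) E (fun Z ↦ koszul g.inner c X Y Z x) x :=
  have := FiniteDimensional.complete ℝ E
  { smul := fun hf hZ ↦ koszul_smul_right g.contMDiff g.symm hc hf hX hY hZ
    add := fun hZ hZ' ↦ koszul_add_right g.contMDiff hc hX hY hZ hZ' }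

open Classical in
/-- The covariant derivative `∇Y` determined by the Koszul formula with torsion 3-form `c`. -/
def koszulDeriv (g : Metric E M) (hc : IsThreeForm c) (Y : ∀ x : M, TangentSpace 𝓘(ℝ, E) x)
    (x : M) : TangentSpace 𝓘(ℝ, E) x →L[ℝ] TangentSpace 𝓘(ℝ, E) x :=
  if hY : MDiffAt (T% Y) x then
    (1 / 2 : ℝ) • (g.inner x).inverse.comp
      (TensorialAt.mkHom₂ (fun X Z ↦ koszul g.inner c X Y Z x) x
        (fun _ hZ ↦ tensorialAt_koszul_left g hc hY hZ)
        (fun _ hX ↦ tensorialAt_koszul_right g hc hX hY))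
  -- A junk value: the axioms of a covariant derivative concern only sections differentiable at the
  -- point.
  else 0

theorem inner_koszulDeriv (g : Metric E M) (hc : IsThreeForm c) (hX : MDiffAt (T% X) x)
    (hY : MDiffAt (T% Y) x) (hZ : MDiffAt (T% Z) x) :
    g.inner x (koszulDeriv g hc Y x (X x)) (Z x) = 1 / 2 * koszul g.inner c X Y Z x := by
  rw [koszulDeriv, dif_pos hY]
  simp only [smul_apply, ContinuousLinearMap.comp_apply, map_smul, smul_eq_mul]
  rw [(g.isInvertible x).self_apply_inverse, TensorialAt.mkHom₂_apply _ _ hX hZ]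

theorem Metric.ext_inner (g : Metric E M) {v w : TangentSpace 𝓘(ℝ, E) x}
    (h : ∀ Z : ∀ x : M, TangentSpace 𝓘(ℝ, E) x, MDiffAt (T% Z) x →
      g.inner x v (Z x) = g.inner x w (Z x)) : v = w := by
  refine (g.isInvertible x).injective (ContinuousLinearMap.ext fun u ↦ ?_)
  obtain ⟨Z, hZ, rfl⟩ := exists_mdifferentiableAt_eq u
  exact h Z hZ

theorem isCovariantDerivativeOn_koszulDeriv (g : Metric E M) (hc : IsThreeForm c) :
    IsCovariantDerivativeOn E (koszulDeriv g hc) Set.univ where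
  add {Y Y' x} hY hY' _ := by
    have := FiniteDimensional.complete ℝ E
    ext u
    obtain ⟨X, hX, rfl⟩ := exists_mdifferentiableAt_eq u
    refine g.ext_inner fun Z hZ ↦ ?_
    rw [inner_koszulDeriv g hc hX (mdifferentiableAt_add_section hY hY') hZ,
      koszul_add_middle g.contMDiff hc hX hY hY' hZ]
    simp only [add_apply, map_add]
    rw [inner_koszulDeriv g hc hX hY hZ, inner_koszulDeriv g hc hX hY' hZ]
    ring
  leibniz {Y f x} hY hf _ := by
    have := FiniteDimensional.complete ℝ E
    ext u
    obtain ⟨X, hX, rfl⟩ := exists_mdifferentiableAt_eq u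
    refine g.ext_inner fun Z hZ ↦ ?_
    rw [inner_koszulDeriv g hc hX (hf.smul_section hY) hZ,
      koszul_smul_middle g.contMDiff g.symm hc hf hX hY hZ]
    simp only [add_apply, map_add, smul_apply, map_smul, smul_eq_mul,
      ContinuousLinearMap.smulRight_apply]
    rw [inner_koszulDeriv g hc hX hY hZ]
    ring

/-- The metric connection of `g` with torsion 3-form `c`. -/
def koszulConnection (g : Metric E M) (hc : IsThreeForm c) : Connection E M where
  toFun := koszulDeriv g hc
  isCovariantDerivativeOnUniv := isCovariantDerivativeOn_koszulDeriv g hc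

theorem inner_koszulConnection (g : Metric E M) (hc : IsThreeForm c) (hX : MDiffAt (T% X) x)
    (hY : MDiffAt (T% Y) x) (hZ : MDiffAt (T% Z) x) :
    g.inner x (koszulConnection g hc Y x (X x)) (Z x) = 1 / 2 * koszul g.inner c X Y Z x :=
  inner_koszulDeriv g hc hX hY hZ

theorem isMetricConnection_koszulConnection (g : Metric E M) (hc : IsThreeForm c) :
    IsMetricConnection g (koszulConnection g hc) := by
  intro x Y Z hY hZ u
  obtain ⟨X, hX, rfl⟩ := exists_mdifferentiableAt_eq u
  rw [inner_koszulConnection g hc hX hY hZ, g.symm x (Y x), inner_koszulConnection g hc hX hZ hY]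
  linarith [koszul_add_swap_right (X := X) (Y := Y) (Z := Z) (x := x) g.symm hc]

/-- The Koszul formula gives `g(T(Y, Z), X) = c(Y, Z, X)`, and `c` is invariant under cyclic
permutation. -/
theorem torsionForm_koszulConnection (g : Metric E M) (hc : IsThreeForm c)
    (hX : MDiffAt (T% X) x) (hY : MDiffAt (T% Y) x) (hZ : MDiffAt (T% Z) x) :
    torsionForm g (koszulConnection g hc) x (X x) (Y x) (Z x) = c X Y Z x := by
  have := FiniteDimensional.complete ℝ E
  unfold torsionForm
  rw [CovariantDerivative.torsion_apply _ hY hZ, g.symm]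
  simp only [map_sub, sub_apply]
  rw [inner_koszulConnection g hc hY hZ hX, inner_koszulConnection g hc hZ hY hX]
  have h1 : c X Y Z x = c Y Z X x := by
    rw [hc.swap_left Y X Z, hc.swap_right Y Z X, neg_neg]
  linarith [koszul_sub_swap_left (X := Y) (Y := Z) (Z := X) (x := x) g.symm hc]

theorem contMDiffCovariantDerivative_koszulConnection (g : Metric E M) (hc : IsThreeForm c) :
    CovariantDerivative.ContMDiffCovariantDerivative (koszulConnection g hc) ∞ where
  contMDiff := ⟨by
    intro Y hY
    have := FiniteDimensional.complete ℝ E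
    rw [contMDiffOn_univ] at hY ⊢
    intro x
    have hY' : CMDiff ∞ (T% Y) := by simpa using hY
    have hY1 (y : M) : MDiffAt (T% Y) y := (hY' y).mdifferentiableAt (by simp)
    refine contMDiffAt_hom_of_apply fun X hX ↦ contMDiffAt_of_pairing g.contMDiff g.pos
      fun Z hZ ↦ ?_
    have h := (contMDiffAt_const (c := (1 / 2 : ℝ))).mul
      (contMDiffAt_koszul g.contMDiff hc hX (hY' x) hZ)
    refine h.congr_of_eventuallyEq ?_
    -- The Koszul formula is needed at all nearby points. Regularity spreads to a neighbourhood only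
    -- at an order other than `∞`, so it is lowered to 1.
    filter_upwards [contMDiffAt_iff_contMDiffAt_nhds (by simp) |>.1 (hX.of_le (m := 1) (by simp)),
      contMDiffAt_iff_contMDiffAt_nhds (by simp) |>.1 (hZ.of_le (m := 1) (by simp))] with y hXy hZy
    exact inner_koszulConnection g hc (hXy.mdifferentiableAt (by simp)) (hY1 y)
      (hZy.mdifferentiableAt (by simp))⟩

end KoszulConnection

/-! ### The torsion candidate `dη(J·, J·, J·)`. -/

section ThreeFormOfTwoForm

variable {E : Type*} [NormedAddCommGroup E] [NormedSpace ℝ E]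
  {M : Type*} [TopologicalSpace M] [ChartedSpace E M] [IsManifold 𝓘(ℝ, E) ∞ M]
  {η : ∀ x : M, TangentSpace 𝓘(ℝ, E) x →L[ℝ] TangentSpace 𝓘(ℝ, E) x →L[ℝ] ℝ}
  {J : ∀ x : M, TangentSpace 𝓘(ℝ, E) x →L[ℝ] TangentSpace 𝓘(ℝ, E) x}

theorem IsComplexStructure.isSmoothEndo (hJ : IsComplexStructure J) : IsSmoothEndo J :=
  hJ.contMDiff

theorem IsTwoForm.neg_swap (hη : IsTwoForm η) (x : M) (v w : TangentSpace 𝓘(ℝ, E) x) :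
    η x v w = -η x w v := by
  have h := hη.alternating x (v + w)
  simp only [map_add, add_apply, hη.alternating] at h
  linarith

/-- The 3-form `(X, Y, Z) ↦ dη(JX, JY, JZ)`. -/
def rotatedExtDeriv (J : ∀ x : M, TangentSpace 𝓘(ℝ, E) x →L[ℝ] TangentSpace 𝓘(ℝ, E) x)
    (η : ∀ x : M, TangentSpace 𝓘(ℝ, E) x →L[ℝ] TangentSpace 𝓘(ℝ, E) x →L[ℝ] ℝ)
    (X Y Z : ∀ x : M, TangentSpace 𝓘(ℝ, E) x) (x : M) : ℝ :=
  extDerivTwo η (fun y ↦ J y (X y)) (fun y ↦ J y (Y y)) (fun y ↦ J y (Z y)) x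

variable [CompleteSpace E] {X Y Z : ∀ x : M, TangentSpace 𝓘(ℝ, E) x} {x : M}

theorem extDerivTwo_neg_left (hη : IsSmoothBilin η) (hη' : ∀ x v w, η x v w = -η x w v)
    (hX : MDiffAt (T% X) x) (hY : MDiffAt (T% Y) x) (hZ : MDiffAt (T% Z) x) :
    extDerivTwo η (-X) Y Z x = -extDerivTwo η X Y Z x := by
  have h : -X = (fun _ : M ↦ (-1 : ℝ)) • X := funext fun y ↦ (neg_one_smul ℝ (X y)).symm
  rw [h, extDerivTwo_smul_left hη hη' mdifferentiableAt_const hX hY hZ, neg_one_mul]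

theorem contMDiffAt_extDerivTwo (hη : IsSmoothBilin η) (hX : CMDiffAt ∞ (T% X) x)
    (hY : CMDiffAt ∞ (T% Y) x) (hZ : CMDiffAt ∞ (T% Z) x) :
    CMDiffAt ∞ (extDerivTwo η X Y Z) x := by
  have h1 := contMDiffAt_mvfderiv_apply (hη.contMDiffAt hY hZ) hX
  have h2 := contMDiffAt_mvfderiv_apply (hη.contMDiffAt hZ hX) hY
  have h3 := contMDiffAt_mvfderiv_apply (hη.contMDiffAt hX hY) hZ
  have h4 := hη.contMDiffAt (contMDiffAt_mlieBracket hX hY) hZ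
  have h5 := hη.contMDiffAt (contMDiffAt_mlieBracket hY hZ) hX
  have h6 := hη.contMDiffAt (contMDiffAt_mlieBracket hZ hX) hY
  exact ((((h1.add h2).add h3).sub h4).sub h5).sub h6

theorem isThreeForm_rotatedExtDeriv (hη : IsTwoForm η) (hJ : IsSmoothEndo J) :
    IsThreeForm (rotatedExtDeriv J η) where
  swap_left _ _ _ _ := extDerivTwo_swap_left hη.neg_swap
  swap_right _ _ _ _ := extDerivTwo_swap_right hη.neg_swap
  add_left {X X' Y Z x} hX hX' hY hZ := by
    have h : (fun y ↦ J y ((X + X') y)) = (fun y ↦ J y (X y)) + fun y ↦ J y (X' y) :=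
      funext fun y ↦ map_add (J y) _ _
    rw [rotatedExtDeriv, h, extDerivTwo_add_left hη.contMDiff (hJ.mdifferentiableAt hX)
      (hJ.mdifferentiableAt hX') (hJ.mdifferentiableAt hY) (hJ.mdifferentiableAt hZ)]
    rfl
  smul_left {X Y Z f x} hf hX hY hZ := by
    have h : (fun y ↦ J y ((f • X) y)) = f • fun y ↦ J y (X y) :=
      funext fun y ↦ map_smul (J y) _ _
    rw [rotatedExtDeriv, h, extDerivTwo_smul_left hη.contMDiff hη.neg_swap hf
      (hJ.mdifferentiableAt hX) (hJ.mdifferentiableAt hY) (hJ.mdifferentiableAt hZ)]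
    rfl
  contMDiffAt hX hY hZ := contMDiffAt_extDerivTwo hη.contMDiff (hJ.contMDiffAt hX)
    (hJ.contMDiffAt hY) (hJ.contMDiffAt hZ)

end ThreeFormOfTwoForm

/-! ### Bismut's identity and parallel complex structures. -/

section Hermitian

variable {E : Type*} [NormedAddCommGroup E] [NormedSpace ℝ E] [FiniteDimensional ℝ E]
  {M : Type*} [TopologicalSpace M] [ChartedSpace E M] [IsManifold 𝓘(ℝ, E) ∞ M]
  {g : Metric E M} {η : ∀ x : M, TangentSpace 𝓘(ℝ, E) x →L[ℝ] TangentSpace 𝓘(ℝ, E) x →L[ℝ] ℝ}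
  {J : ∀ x : M, TangentSpace 𝓘(ℝ, E) x →L[ℝ] TangentSpace 𝓘(ℝ, E) x}
  {X Y Z : ∀ x : M, TangentSpace 𝓘(ℝ, E) x} {x : M}

/-- The Bismut identity: the Koszul expression with torsion `dη(J·, J·, J·)`, where `η` is the
fundamental form of the Hermitian structure `(g, J)`, is skew-Hermitian. -/
theorem koszul_complexStructure (hJ : IsComplexStructure J) (hgJ : IsHermitian g J)
    (hηs : IsSmoothBilin η) (hη : ∀ x v w, η x v w = g.inner x (J x v) w)
    (hX : MDiffAt (T% X) x) (hY : MDiffAt (T% Y) x) (hZ : MDiffAt (T% Z) x) :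
    koszul g.inner (rotatedExtDeriv J η) X (fun y ↦ J y (Y y)) Z x =
      -koszul g.inner (rotatedExtDeriv J η) X Y (fun y ↦ J y (Z y)) x := by
  have := FiniteDimensional.complete ℝ E
  have hX' := hJ.isSmoothEndo.mdifferentiableAt hX
  have hY' := hJ.isSmoothEndo.mdifferentiableAt hY
  have hZ' := hJ.isSmoothEndo.mdifferentiableAt hZ
  have hskew (y : M) (v w : TangentSpace 𝓘(ℝ, E) y) :
      g.inner y v (J y w) = -g.inner y (J y v) w := by
    rw [← hgJ y v, hJ.sq, map_neg]
  have hη₁ (y : M) (v w : TangentSpace 𝓘(ℝ, E) y) : η y v (J y w) = g.inner y v w := by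
    rw [hη, hgJ]
  have hη₂ (y : M) (v w : TangentSpace 𝓘(ℝ, E) y) : η y (J y v) w = -g.inner y v w := by
    rw [hη, hJ.sq, map_neg, neg_apply]
  have hηa (y : M) (v w : TangentSpace 𝓘(ℝ, E) y) : η y v w = -η y w v := by
    rw [hη, hη, g.symm, hskew]
  have hJJ (V : ∀ x : M, TangentSpace 𝓘(ℝ, E) x) : (fun y ↦ J y (J y (V y))) = -V :=
    funext fun y ↦ hJ.sq y _
  have hd (V W : ∀ x : M, TangentSpace 𝓘(ℝ, E) x) (u : TangentSpace 𝓘(ℝ, E) x) :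
      d% (fun y ↦ g.inner y (V y) (J y (W y))) x u =
        -d% (fun y ↦ g.inner y (J y (V y)) (W y)) x u := by
    simp only [hskew]
    rw [mvfderiv_fun_neg]; rfl
  have hd' (V W : ∀ x : M, TangentSpace 𝓘(ℝ, E) x) (u : TangentSpace 𝓘(ℝ, E) x) :
      d% (fun y ↦ -g.inner y (V y) (W y)) x u = -d% (fun y ↦ g.inner y (V y) (W y)) x u := by
    rw [mvfderiv_fun_neg]; rfl
  have hc₁ : rotatedExtDeriv J η X (fun y ↦ J y (Y y)) Z x =
      -extDerivTwo η (fun y ↦ J y (X y)) Y (fun y ↦ J y (Z y)) x := by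
    rw [rotatedExtDeriv, hJJ, extDerivTwo_swap_left hηa, extDerivTwo_neg_left hηs hηa hY hX' hZ',
      extDerivTwo_swap_left (X := Y) hηa]
  have hc₂ : rotatedExtDeriv J η X Y (fun y ↦ J y (Z y)) x =
      -extDerivTwo η (fun y ↦ J y (X y)) (fun y ↦ J y (Y y)) Z x := by
    rw [rotatedExtDeriv, hJJ, ← extDerivTwo_rotate, ← extDerivTwo_rotate,
      extDerivTwo_neg_left hηs hηa hZ hX' hY', extDerivTwo_rotate, extDerivTwo_rotate]
  -- After everything is written through `g`, the derivative terms cancel, as do the brackets of the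
  -- `Y` and `Z` fields. The eight brackets left are exactly `g(J N(X,Y), Z)` and `g(J N(X,Z), Y)`
  -- expanded, with `N` the Nijenhuis tensor.
  have hN₁ := congrArg (fun v ↦ g.inner x (J x v) (Z x)) (hJ.nijenhuis_eq_zero x X Y hX hY)
  have hN₂ := congrArg (fun v ↦ g.inner x (J x v) (Y x)) (hJ.nijenhuis_eq_zero x X Z hX hZ)
  simp only [nijenhuis, map_sub, hJ.sq, map_neg, sub_apply, neg_apply, map_zero, zero_apply]
    at hN₁ hN₂
  unfold koszul
  rw [hc₁, hc₂]
  unfold extDerivTwo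
  simp only [hη₁]
  simp only [hη₂]
  simp only [hη, hd']
  rw [hd Y Z, hd X Y, mvfderiv_symm (X := X) (Y := fun y ↦ J y (Z y)) g.symm,
    mvfderiv_symm (X := Z) (Y := X) g.symm, hskew, hskew,
    VectorField.mlieBracket_swap_apply (V := fun y ↦ J y (Z y)) (W := fun y ↦ J y (X y)),
    VectorField.mlieBracket_swap_apply (V := Z) (W := fun y ↦ J y (X y))]
  simp only [map_neg, neg_apply]
  linarith

/-- Keeping `c` separate from the form attached to `J` lets one connection serve two complex
structures whose torsion candidates agree. -/
theorem isParallel_koszulConnection {c : (∀ x : M, TangentSpace 𝓘(ℝ, E) x) →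
      (∀ x : M, TangentSpace 𝓘(ℝ, E) x) → (∀ x : M, TangentSpace 𝓘(ℝ, E) x) → M → ℝ}
    (hc : IsThreeForm c) (hJ : IsComplexStructure J) (hgJ : IsHermitian g J)
    (hηs : IsSmoothBilin η) (hη : ∀ x v w, η x v w = g.inner x (J x v) w)
    (hcη : ∀ {X Y Z : ∀ x : M, TangentSpace 𝓘(ℝ, E) x} {x : M}, MDiffAt (T% X) x →
      MDiffAt (T% Y) x → MDiffAt (T% Z) x → c X Y Z x = rotatedExtDeriv J η X Y Z x) :
    IsParallel (koszulConnection g hc) J := by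
  intro x Y hY u
  obtain ⟨X, hX, rfl⟩ := exists_mdifferentiableAt_eq u
  refine g.ext_inner fun Z hZ ↦ ?_
  have hY' := hJ.isSmoothEndo.mdifferentiableAt hY
  have hZ' := hJ.isSmoothEndo.mdifferentiableAt hZ
  have hskew (v w : TangentSpace 𝓘(ℝ, E) x) :
      g.inner x (J x v) w = -g.inner x v (J x w) := by
    rw [← hgJ x v, hJ.sq, map_neg, neg_neg]
  rw [hskew, inner_koszulConnection g hc hX hY' hZ, inner_koszulConnection g hc hX hY hZ']
  have h := koszul_complexStructure hJ hgJ hηs hη hX hY hZ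
  unfold koszul at h ⊢
  rw [hcη hX hY' hZ, hcη hX hY hZ', h]
  ring

end Hermitian

/-! ### Dolbeault conditions as real equations. -/

section ComplexDerivative

variable {E : Type*} [NormedAddCommGroup E] [NormedSpace ℝ E]
  {M : Type*} [TopologicalSpace M] [ChartedSpace E M]

theorem mvfderiv_ofReal_add_mul {f h : M → ℝ} {x : M} (hf : MDiffAt f x) (hh : MDiffAt h x)
    (c : ℂ) (u : TangentSpace 𝓘(ℝ, E) x) :
    d% (fun y ↦ (f y : ℂ) + c * (h y : ℂ)) x u = (d% f x u : ℂ) + c * (d% h x u : ℂ) := by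
  have hL (k : M → ℝ) (hk : MDiffAt k x) (L : ℝ →L[ℝ] ℂ) :
      MDifferentiableAt 𝓘(ℝ, E) 𝓘(ℝ, ℂ) (fun y ↦ L (k y)) x ∧ d% (fun y ↦ L (k y)) x u = L (d% k x u) := by
    have h1 : MDifferentiableAt 𝓘(ℝ, ℝ) 𝓘(ℝ, ℂ) L (k x) := L.differentiableAt.mdifferentiableAt
    refine ⟨h1.comp x hk, ?_⟩
    have h2 := mfderiv_comp x h1 hk
    have h3 : mfderiv 𝓘(ℝ, ℝ) 𝓘(ℝ, ℂ) L (k x) = L := by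
      rw [mfderiv_eq_fderiv]; exact L.fderiv
    rw [h3] at h2
    exact congrArg (fun A : TangentSpace 𝓘(ℝ, E) x →L[ℝ] ℂ ↦ A u) h2
  obtain ⟨h1, h2⟩ := hL f hf Complex.ofRealCLM
  obtain ⟨h3, h4⟩ := hL h hh (c • Complex.ofRealCLM)
  have h5 := mvfderiv_fun_add h1 h3
  have h6 := congrArg (fun A : TangentSpace 𝓘(ℝ, E) x →L[ℝ] ℂ ↦ A u) h5
  rw [add_apply, h2, h4] at h6
  exact h6

variable {α β : ∀ x : M, TangentSpace 𝓘(ℝ, E) x →L[ℝ] TangentSpace 𝓘(ℝ, E) x →L[ℝ] ℝ}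
  {J : ∀ x : M, TangentSpace 𝓘(ℝ, E) x →L[ℝ] TangentSpace 𝓘(ℝ, E) x}
  {X Y Z : ∀ x : M, TangentSpace 𝓘(ℝ, E) x} {x : M}

theorem IsTypeZeroTwo.rotate (h : IsTypeZeroTwo J (complexForm α β (-Complex.I))) (x : M)
    (v w : TangentSpace 𝓘(ℝ, E) x) : α x (J x v) w = -β x v w ∧ β x (J x v) w = α x v w := by
  have h1 := (h x v w).1
  rw [complexForm_apply, complexForm_apply, Complex.ext_iff] at h1
  simp at h1
  constructor <;> linarith [h1.1, h1.2]

variable [IsManifold 𝓘(ℝ, E) ∞ M]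

theorem extDerivTwo_complexForm (hα : IsSmoothBilin α) (hβ : IsSmoothBilin β) (c : ℂ)
    (hX : MDiffAt (T% X) x) (hY : MDiffAt (T% Y) x) (hZ : MDiffAt (T% Z) x) :
    extDerivTwo (complexForm α β c) X Y Z x =
      ((extDerivTwo α X Y Z x : ℝ) : ℂ) + c * ((extDerivTwo β X Y Z x : ℝ) : ℂ) := by
  unfold extDerivTwo
  simp only [complexForm_apply]
  rw [mvfderiv_ofReal_add_mul (hα.mdifferentiableAt hY hZ) (hβ.mdifferentiableAt hY hZ),
    mvfderiv_ofReal_add_mul (hα.mdifferentiableAt hZ hX) (hβ.mdifferentiableAt hZ hX),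
    mvfderiv_ofReal_add_mul (hα.mdifferentiableAt hX hY) (hβ.mdifferentiableAt hX hY)]
  push_cast
  ring

/-- The inner `J` of `JdJ` acts as -1, cancelling the sign in the action on 3-forms. -/
theorem dcTwo_complexForm (hα : IsSmoothBilin α) (hβ : IsSmoothBilin β) (hJ : IsSmoothEndo J)
    (hαJ : ∀ x v w, α x (J x v) (J x w) = -α x v w)
    (hβJ : ∀ x v w, β x (J x v) (J x w) = -β x v w) (c : ℂ)
    (hX : MDiffAt (T% X) x) (hY : MDiffAt (T% Y) x) (hZ : MDiffAt (T% Z) x) :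
    dcTwo J (complexForm α β c) X Y Z x =
      ((rotatedExtDeriv J α X Y Z x : ℝ) : ℂ) + c * ((rotatedExtDeriv J β X Y Z x : ℝ) : ℂ) := by
  have hact : actTwo J (complexForm α β c) = fun x ↦ -complexForm α β c x := by
    funext y
    ext v w
    change complexForm α β c y (J y v) (J y w) = -complexForm α β c y v w
    simp only [complexForm_apply, hαJ, hβJ, Complex.ofReal_neg]
    ring
  have hd (η : ∀ x : M, TangentSpace 𝓘(ℝ, E) x →L[ℝ] TangentSpace 𝓘(ℝ, E) x →L[ℝ] ℂ)
      (V W U : ∀ x : M, TangentSpace 𝓘(ℝ, E) x) :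
      extDerivTwo (fun x ↦ -η x) V W U x = -extDerivTwo η V W U x := by
    unfold extDerivTwo
    simp only [neg_apply, mvfderiv_fun_neg]
    ring
  rw [dcTwo, hact, hd, neg_neg, extDerivTwo_complexForm hα hβ c (hJ.mdifferentiableAt hX)
    (hJ.mdifferentiableAt hY) (hJ.mdifferentiableAt hZ), rotatedExtDeriv, rotatedExtDeriv]

/-- `∂̄(α - iβ) = 0` in terms of real 3-forms, for `α - iβ` of type `(0,2)` or `(2,0)`. -/
theorem isDelbarClosed_complexForm_iff (hα : IsSmoothBilin α) (hβ : IsSmoothBilin β)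
    (hJ : IsSmoothEndo J) (hαJ : ∀ x v w, α x (J x v) (J x w) = -α x v w)
    (hβJ : ∀ x v w, β x (J x v) (J x w) = -β x v w) :
    IsDelbarClosed J (complexForm α β (-Complex.I)) ↔
      ∀ (x : M) (X Y Z : ∀ x : M, TangentSpace 𝓘(ℝ, E) x),
        MDiffAt (T% X) x → MDiffAt (T% Y) x → MDiffAt (T% Z) x →
        extDerivTwo α X Y Z x = rotatedExtDeriv J β X Y Z x ∧
          extDerivTwo β X Y Z x = -rotatedExtDeriv J α X Y Z x := by
  unfold IsDelbarClosed
  refine forall_congr' fun x ↦ forall_congr' fun X ↦ forall_congr' fun Y ↦ forall_congr' fun Z ↦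
    forall_congr' fun hX ↦ forall_congr' fun hY ↦ forall_congr' fun hZ ↦ ?_
  rw [delbarTwo, extDerivTwo_complexForm hα hβ _ hX hY hZ,
    dcTwo_complexForm hα hβ hJ hαJ hβJ _ hX hY hZ, Complex.ext_iff]
  simp
  constructor <;> rintro ⟨h1, h2⟩ <;> constructor <;> linarith

/-- `∂(α + iβ) = 0` in terms of real 3-forms, for `α + iβ` of type `(0,2)` or `(2,0)`. -/
theorem isDelClosed_complexForm_iff (hα : IsSmoothBilin α) (hβ : IsSmoothBilin β)
    (hJ : IsSmoothEndo J) (hαJ : ∀ x v w, α x (J x v) (J x w) = -α x v w)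
    (hβJ : ∀ x v w, β x (J x v) (J x w) = -β x v w) :
    IsDelClosed J (complexForm α β Complex.I) ↔
      ∀ (x : M) (X Y Z : ∀ x : M, TangentSpace 𝓘(ℝ, E) x),
        MDiffAt (T% X) x → MDiffAt (T% Y) x → MDiffAt (T% Z) x →
        extDerivTwo α X Y Z x = rotatedExtDeriv J β X Y Z x ∧
          extDerivTwo β X Y Z x = -rotatedExtDeriv J α X Y Z x := by
  unfold IsDelClosed
  refine forall_congr' fun x ↦ forall_congr' fun X ↦ forall_congr' fun Y ↦ forall_congr' fun Z ↦
    forall_congr' fun hX ↦ forall_congr' fun hY ↦ forall_congr' fun hZ ↦ ?_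
  rw [delTwo, extDerivTwo_complexForm hα hβ _ hX hY hZ,
    dcTwo_complexForm hα hβ hJ hαJ hβJ _ hX hY hZ, Complex.ext_iff]
  simp
  constructor <;> rintro ⟨h1, h2⟩ <;> constructor <;> linarith

end ComplexDerivative

/-! ### The Riemannian metric defined by the 2-form. -/

section HyperHermitian

variable {E : Type*} [NormedAddCommGroup E] [NormedSpace ℝ E] [FiniteDimensional ℝ E]
  {M : Type*} [TopologicalSpace M] [ChartedSpace E M] [IsManifold 𝓘(ℝ, E) ∞ M]

/-- By compactness `b v v` has a positive minimum `m` on the unit sphere, so `m‖v‖² ≤ b v v`. An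
empty sphere means `E = 0`. -/
theorem isVonNBounded_of_pos (b : E →L[ℝ] E →L[ℝ] ℝ) (hpos : ∀ v, v ≠ 0 → 0 < b v v) :
    Bornology.IsVonNBounded ℝ {v : E | b v v < 1} := by
  rw [NormedSpace.isVonNBounded_iff]
  have := FiniteDimensional.proper_real E
  rcases (Metric.sphere (0 : E) 1).eq_empty_or_nonempty with hS | hS
  · refine Bornology.isBounded_singleton (x := (0 : E)) |>.subset fun v _ ↦ ?_
    by_contra hv
    have : ‖v‖⁻¹ • v ∈ Metric.sphere (0 : E) 1 := by
      simp [norm_smul, inv_mul_cancel₀ (norm_ne_zero_iff.2 hv)]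
    rw [hS] at this
    exact this
  · obtain ⟨v₀, hv₀, hmin⟩ := (isCompact_sphere (0 : E) 1).exists_isMinOn hS
      (f := fun v ↦ b v v)
      (b.continuous.clm_apply continuous_id).continuousOn
    have hm : 0 < b v₀ v₀ := hpos v₀ (by rintro rfl; simp at hv₀)
    refine (Metric.isBounded_iff_subset_closedBall 0).2 ⟨√(b v₀ v₀)⁻¹, fun v hv ↦ ?_⟩
    rw [mem_closedBall_zero_iff]
    refine Real.le_sqrt_of_sq_le ?_
    rcases eq_or_ne v 0 with rfl | hv0
    · simpa using hm.le
    have hn : 0 < ‖v‖ := norm_pos_iff.2 hv0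
    have h1 : b v₀ v₀ ≤ b (‖v‖⁻¹ • v) (‖v‖⁻¹ • v) :=
      hmin (by simp [norm_smul, inv_mul_cancel₀ hn.ne'])
    simp only [map_smul, smul_apply, smul_eq_mul] at h1
    have h2 : b v₀ v₀ * ‖v‖ ^ 2 ≤ b v v := by
      calc b v₀ v₀ * ‖v‖ ^ 2 ≤ (‖v‖⁻¹ * (‖v‖⁻¹ * b v v)) * ‖v‖ ^ 2 := by gcongr
        _ = b v v := by field_simp
    rw [← one_div, le_div_iff₀ hm]
    have h3 : b v v < 1 := hv
    linarith

theorem isSmoothBilin_comp_endo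
    {b : ∀ x : M, TangentSpace 𝓘(ℝ, E) x →L[ℝ] TangentSpace 𝓘(ℝ, E) x →L[ℝ] ℝ}
    {J : ∀ x : M, TangentSpace 𝓘(ℝ, E) x →L[ℝ] TangentSpace 𝓘(ℝ, E) x}
    (hb : IsSmoothBilin b) (hJ : IsSmoothEndo J) : IsSmoothBilin fun x ↦ -(b x).comp (J x) := by
  intro x
  refine contMDiffAt_hom_of_apply (F := E →L[ℝ] ℝ)
    (V := fun x : M ↦ TangentSpace 𝓘(ℝ, E) x →L[ℝ] ℝ) fun X hX ↦ ?_
  have h := ContMDiffAt.clm_bundle_apply (F₁ := E) (F₂ := E →L[ℝ] ℝ)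
    (E₂ := fun x : M ↦ TangentSpace 𝓘(ℝ, E) x →L[ℝ] ℝ) (hb x) (hJ.contMDiffAt hX)
  exact h.neg_section

/-- The Riemannian metric `-b(J·, ·)`, when it is symmetric and positive definite. -/
def metricOfForm {b : ∀ x : M, TangentSpace 𝓘(ℝ, E) x →L[ℝ] TangentSpace 𝓘(ℝ, E) x →L[ℝ] ℝ}
    {J : ∀ x : M, TangentSpace 𝓘(ℝ, E) x →L[ℝ] TangentSpace 𝓘(ℝ, E) x}
    (hb : IsSmoothBilin b) (hJ : IsSmoothEndo J)
    (hsymm : ∀ x v w, -b x (J x v) w = -b x (J x w) v)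
    (hpos : ∀ x v, v ≠ 0 → 0 < -b x (J x v) v) : Metric E M where
  inner x := -(b x).comp (J x)
  symm := hsymm
  pos := hpos
  isVonNBounded x := isVonNBounded_of_pos (E := E) (-(b x).comp (J x)) (hpos x)
  contMDiff := isSmoothBilin_comp_endo hb hJ

end HyperHermitian

/-! ### Skewness of the three structures and the hyper-Hermitian condition. -/

section Quaternions

variable {E : Type*} [NormedAddCommGroup E] [NormedSpace ℝ E]
  {M : Type*} [TopologicalSpace M] [ChartedSpace E M] [IsManifold 𝓘(ℝ, E) ∞ M]

/-- Moving every structure to the second argument, the mixed terms cancel by anticommutation and the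
squares contribute `a₁² + a₂² + a₃² = 1`. -/
theorem isHyperHermitian_of_skew (Q : HypercomplexStructure E M) (g : Metric E M)
    (h₁ : ∀ x v w, g.inner x (Q.I₁ x v) w = -g.inner x v (Q.I₁ x w))
    (h₂ : ∀ x v w, g.inner x (Q.I₂ x v) w = -g.inner x v (Q.I₂ x w))
    (h₃ : ∀ x v w, g.inner x (Q.I₃ x v) w = -g.inner x v (Q.I₃ x w)) :
    IsHyperHermitian Q g := by
  intro a₁ a₂ a₃ ha x v w
  have h₂₃ (u) : Q.I₂ x (Q.I₃ x u) = Q.I₁ x u := by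
    rw [← Q.mul₁₂, Q.mul₂₁, ← Q.mul₁₂, Q.isComplex₂.sq, map_neg, neg_neg]
  have h₃₂ (u) : Q.I₃ x (Q.I₂ x u) = -Q.I₁ x u := by
    rw [← Q.mul₁₂, Q.isComplex₂.sq, map_neg]
  have h₁₃ (u) : Q.I₁ x (Q.I₃ x u) = -Q.I₂ x u := by
    rw [← Q.mul₁₂, Q.isComplex₁.sq]
  have h₃₁ (u) : Q.I₃ x (Q.I₁ x u) = Q.I₂ x u := by
    rw [← Q.mul₁₂, Q.mul₂₁, map_neg, h₁₃, neg_neg]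
  simp only [add_apply, smul_apply, map_add, map_smul, smul_eq_mul]
  simp only [h₁, h₂, h₃, Q.mul₁₂, Q.mul₂₁, h₂₃, h₃₂, h₁₃, h₃₁, Q.isComplex₁.sq, Q.isComplex₂.sq,
    Q.isComplex₃.sq, map_neg]
  linear_combination g.inner x v w * ha

end Quaternions

end

end HKT

/-! ### Assembly of the theorem. -/

theorem mainTheorem2
    {E : Type*} [NormedAddCommGroup E] [NormedSpace ℝ E] [FiniteDimensional ℝ E]
    {M : Type*} [TopologicalSpace M] [T2Space M] [SecondCountableTopology M]
    [ChartedSpace E M] [IsManifold 𝓘(ℝ, E) ∞ M]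
    (Q : HKT.HypercomplexStructure E M)
    (F₂ F₃ : ∀ x : M, TangentSpace 𝓘(ℝ, E) x →L[ℝ] TangentSpace 𝓘(ℝ, E) x →L[ℝ] ℝ)
    (hF₂ : HKT.IsTwoForm F₂) (hF₃ : HKT.IsTwoForm F₃)
    (htype : HKT.IsTypeZeroTwo Q.I₁ (HKT.complexForm F₂ F₃ (-Complex.I)))
    (hsymm : ∀ (x : M) (v w : TangentSpace 𝓘(ℝ, E) x),
      -F₂ x (Q.I₂ x v) w = -F₂ x (Q.I₂ x w) v)
    (hpos : ∀ (x : M) (v : TangentSpace 𝓘(ℝ, E) x), v ≠ 0 → 0 < -F₂ x (Q.I₂ x v) v) :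
    (HKT.IsDelbarClosed Q.I₁ (HKT.complexForm F₂ F₃ (-Complex.I)) ↔
      HKT.IsDelClosed Q.I₁ (HKT.complexForm F₂ F₃ Complex.I)) ∧
    (HKT.IsDelbarClosed Q.I₁ (HKT.complexForm F₂ F₃ (-Complex.I)) →
      ∃ g : HKT.Metric E M,
        (∀ (x : M) (v w : TangentSpace 𝓘(ℝ, E) x), g.inner x v w = -F₂ x (Q.I₂ x v) w) ∧
        HKT.IsHyperHermitian Q g ∧ HKT.IsHKT Q g) := by
  have h₂J (x : M) (v w : TangentSpace 𝓘(ℝ, E) x) :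
      F₂ x (Q.I₁ x v) (Q.I₁ x w) = -F₂ x v w := by
    rw [(htype.rotate x _ _).1, hF₃.neg_swap, (htype.rotate x _ _).2, neg_neg, hF₂.neg_swap]
  have h₃J (x : M) (v w : TangentSpace 𝓘(ℝ, E) x) :
      F₃ x (Q.I₁ x v) (Q.I₁ x w) = -F₃ x v w := by
    rw [(htype.rotate x _ _).2, hF₂.neg_swap, (htype.rotate x _ _).1, neg_neg, hF₃.neg_swap]
  have hbar := HKT.isDelbarClosed_complexForm_iff hF₂.contMDiff hF₃.contMDiff
    Q.isComplex₁.isSmoothEndo h₂J h₃J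
  refine ⟨hbar.trans (HKT.isDelClosed_complexForm_iff hF₂.contMDiff hF₃.contMDiff
    Q.isComplex₁.isSmoothEndo h₂J h₃J).symm, fun hclosed ↦ ?_⟩
  have := FiniteDimensional.complete ℝ E
  let g : HKT.Metric E M :=
    HKT.metricOfForm hF₂.contMDiff Q.isComplex₂.isSmoothEndo hsymm hpos
  have hg (x : M) (v w : TangentSpace 𝓘(ℝ, E) x) : g.inner x v w = -F₂ x (Q.I₂ x v) w := rfl
  have hF₂g (x : M) (v w : TangentSpace 𝓘(ℝ, E) x) : F₂ x v w = g.inner x (Q.I₂ x v) w := by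
    rw [hg, Q.isComplex₂.sq, map_neg, neg_apply, neg_neg]
  -- The type condition gives `F₃ = -F₂(I₁·, ·) = -g(I₂I₁·, ·)`, and `I₂I₁ = -I₃`.
  have hF₃g (x : M) (v w : TangentSpace 𝓘(ℝ, E) x) : F₃ x v w = g.inner x (Q.I₃ x v) w := by
    have h := (htype.rotate x v w).1
    rw [hF₂g, Q.mul₂₁, map_neg, neg_apply] at h
    linarith
  have hsk₂ (x : M) (v w : TangentSpace 𝓘(ℝ, E) x) :
      g.inner x (Q.I₂ x v) w = -g.inner x v (Q.I₂ x w) := by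
    rw [← hF₂g, hF₂.neg_swap, hF₂g, g.symm]
  have hsk₃ (x : M) (v w : TangentSpace 𝓘(ℝ, E) x) :
      g.inner x (Q.I₃ x v) w = -g.inner x v (Q.I₃ x w) := by
    rw [← hF₃g, hF₃.neg_swap, hF₃g, g.symm]
  have h₂₃ (x : M) (v : TangentSpace 𝓘(ℝ, E) x) : Q.I₂ x (Q.I₃ x v) = Q.I₁ x v := by
    rw [← Q.mul₁₂, Q.mul₂₁, ← Q.mul₁₂, Q.isComplex₂.sq, map_neg, neg_neg]
  have h₃₂ (x : M) (v : TangentSpace 𝓘(ℝ, E) x) : Q.I₃ x (Q.I₂ x v) = -Q.I₁ x v := by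
    rw [← Q.mul₁₂, Q.isComplex₂.sq, map_neg]
  have hsk₁ (x : M) (v w : TangentSpace 𝓘(ℝ, E) x) :
      g.inner x (Q.I₁ x v) w = -g.inner x v (Q.I₁ x w) := by
    rw [← h₂₃, hsk₂, hsk₃, h₃₂, map_neg, neg_neg]
  have hQg := HKT.isHyperHermitian_of_skew Q g hsk₁ hsk₂ hsk₃
  have hHerm₂ : HKT.IsHermitian g Q.I₂ := fun x v w ↦ by
    rw [hsk₂, Q.isComplex₂.sq, map_neg, neg_neg]
  have hHerm₃ : HKT.IsHermitian g Q.I₃ := fun x v w ↦ by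
    rw [hsk₃, Q.isComplex₃.sq, map_neg, neg_neg]
  have hc := HKT.isThreeForm_rotatedExtDeriv hF₂ Q.isComplex₂.isSmoothEndo
  -- The HKT condition: evaluating `dF₂ = dF₃(I₁·, I₁·, I₁·)` on `I₂X, I₂Y, I₂Z` and using `I₁I₂ =
  -- I₃` identifies the two torsions.
  have hc₃ {X Y Z : ∀ x : M, TangentSpace 𝓘(ℝ, E) x} {x : M} (hX : MDiffAt (T% X) x)
      (hY : MDiffAt (T% Y) x) (hZ : MDiffAt (T% Z) x) :
      HKT.rotatedExtDeriv Q.I₂ F₂ X Y Z x = HKT.rotatedExtDeriv Q.I₃ F₃ X Y Z x := by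
    have h := (hbar.1 hclosed x _ _ _ (Q.isComplex₂.isSmoothEndo.mdifferentiableAt hX)
      (Q.isComplex₂.isSmoothEndo.mdifferentiableAt hY)
      (Q.isComplex₂.isSmoothEndo.mdifferentiableAt hZ)).1
    simpa only [HKT.rotatedExtDeriv, Q.mul₁₂] using h
  have hpar₂ := HKT.isParallel_koszulConnection hc Q.isComplex₂ hHerm₂ hF₂.contMDiff hF₂g
    fun _ _ _ ↦ rfl
  have hpar₃ := HKT.isParallel_koszulConnection hc Q.isComplex₃ hHerm₃ hF₃.contMDiff hF₃g hc₃
  refine ⟨g, hg, hQg, hQg, HKT.koszulConnection g hc,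
    { smooth := HKT.contMDiffCovariantDerivative_koszulConnection g hc
      metric := HKT.isMetricConnection_koszulConnection g hc
      parallel₁ := fun x Y hY u ↦ ?_
      parallel₂ := hpar₂
      parallel₃ := hpar₃
      skew₁₂ := fun x u v w ↦ ?_
      skew₂₃ := fun x u v w ↦ ?_ }⟩
  -- `I₁ = I₂I₃` is a product of parallel endomorphisms.
  · have h := hpar₂ x _ (Q.isComplex₃.isSmoothEndo.mdifferentiableAt hY) u
    rw [hpar₃ x Y hY] at h
    simpa only [h₂₃] using h
  all_goals
    obtain ⟨X, hX, rfl⟩ := HKT.exists_mdifferentiableAt_eq u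
    obtain ⟨Y, hY, rfl⟩ := HKT.exists_mdifferentiableAt_eq v
    obtain ⟨Z, hZ, rfl⟩ := HKT.exists_mdifferentiableAt_eq w
  · rw [HKT.torsionForm_koszulConnection g hc hX hY hZ,
      HKT.torsionForm_koszulConnection g hc hY hX hZ, hc.swap_left X Y, neg_neg]
  · rw [HKT.torsionForm_koszulConnection g hc hX hY hZ,
      HKT.torsionForm_koszulConnection g hc hX hZ hY, hc.swap_right X Y, neg_neg]
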